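/- Let $\mathbb{I}\subset\mathbb{C}$ be an imaginary quadratic field with ring of integers $\mathbb{Z}_{\mathbb{I}}$. Let $m_1\ge 1$ and $m_2\ge \max(4,\,m_1+1)$ be integers, let $\beta_0=0,\beta_1,\dots,\beta_{m_1}$ be pairwise different non-negative integers, and let $H>0$ be a real number with $$\log H\ \ge\ m_2(\log m_2)^2\,e^{m_2(\log m_2)^2}.$$ Let $(\lambda_0,\lambda_1,\dots,\lambda_{m_1})\in\mathbb{Z}_{\mathbb{I}}^{m_1+1}\setminus\{\overline 0\}$ satisfy $\max_{1\le j\le m_1}|\lambda_j|\le H$ (no bound on $\lambda_0$ is required), and suppose that the polynomial $$P(x)=\lambda_0+\lambda_1x^{\beta_1}+\dots+\lambda_{m_1}x^{\beta_{m_1}}$$ (which has at most $m_1+1$ non-zero coefficients) has degree at most $m_2$. Then $$|P(e)|\;>\;H^{-m_1-\frac{\rho\,(m_1^2+3m_1+2)\log m_2}{\log\log H}}$$ holds with $\rho=12.88$, and, if $m_2\ge 11$, it holds with $\rho=2$. -/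

import Mathlib

open scoped Polynomial NumberField

/-- The polynomial `λ₀ x ^ β₀ + λ₁ x ^ β₁ + ⋯ + λₘ x ^ βₘ` with exponents `β` and coefficients
`lam`. -/
noncomputable def sparsePoly {R : Type*} [CommRing R] {m : ℕ} (β : Fin (m + 1) → ℕ)
    (lam : Fin (m + 1) → R) : R[X] :=
  ∑ j, Polynomial.C (lam j) * Polynomial.X ^ β j

/-- The value `P(e) ∈ ℂ` of a polynomial `P` over the ring of integers of `K`, the field `K` being
regarded as a subfield of `ℂ` through the embedding `σ`. -/
noncomputable def evalAtE {K : Type*} [Field K] (σ : K →+* ℂ) (P : (𝓞 K)[X]) : ℂ :=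
  P.eval₂ (σ.comp (algebraMap (𝓞 K) K)) (Complex.exp 1)

/-- The lower bound `H ^ (-m₁ - ρ (m₁² + 3 m₁ + 2) log m₂ / log log H)`. -/
noncomputable def sparseBound (ρ : ℝ) (m₁ m₂ : ℕ) (H : ℝ) : ℝ :=
  H ^ (-(m₁ : ℝ) -
    ρ * ((m₁ : ℝ) ^ 2 + 3 * (m₁ : ℝ) + 2) * Real.log (m₂ : ℝ) / Real.log (Real.log H))

/-! The method is Hermite's. Let `S` contain `0` and the support of `P`, with `n + 1` elements, all
at most `M`. For `k` in `S` put `f_k = (x - k)^(ℓ-1) ∏_{j ≠ k} (x - j)^ℓ` and let `F_k` be the sum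
of all its derivatives. Then `F_k(j) = (ℓ-1)! b_kj` with integers `b_kj`. If a prime `p > M` divides
`ℓ`, the matrix `b` is diagonal and invertible mod `p`, hence nonsingular, so some `k` gives `∑ b_kj
λ_j ≠ 0`. A nonzero integer of an imaginary quadratic field has absolute value at least 1, hence `|∑
λ_j F_k(j)| ≥ (ℓ-1)!`.

On the other side, `F_k(0) P(e) = ∑ λ_j F_k(j) + ∑ λ_j (e^j F_k(0) - F_k(j))`, where the last sum is
at most `n H e^M M^((n+1)ℓ)`. Once this is below half of `(ℓ-1)!`, the bound `|F_k(0)| ≤ ((n+1)ℓ-1)!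
e^M` gives `(ℓ-1)! ≤ 2 |P(e)| ((n+1)ℓ-1)! e^M` (`factorial_le_norm_sum_mul_exp`).

Take `ℓ = M! t + 1`, all of whose prime factors exceed `M`, with `t` minimal. Minimality makes `log
ℓ!` at most `log H + (n+1) ℓ log M` plus small terms, and `ℓ ≤ A = ρ log H / log log H`. Taking
logarithms gives the exponent, with `(n+1)(n+2) = n² + 3n + 2` (`rpow_lt_norm_sum_mul_exp`). The
rest checks that `A` is large enough for each value of `ρ`. -/

/-! ### Hermite's polynomials and a system nonsingular mod p -/

open Polynomial in
/-- Hermite's auxiliary polynomial with zeros of order `ℓ` at the points of `S`, except for a zero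
of order `ℓ - 1` at `k`. -/
noncomputable def hermitePoly (S : Finset ℕ) (ℓ k : ℕ) : ℤ[X] :=
  (X - C (k : ℤ)) ^ (ℓ - 1) * ∏ j ∈ S.erase k, (X - C (j : ℤ)) ^ ℓ

-- At a zero of order `ℓ` every surviving derivative contributes a multiple of `ℓ! = (ℓ-1)! ℓ`. At
-- `k`, of order `ℓ - 1`, there is the additional term `(ℓ-1)! ∏ (k - i)^ℓ`, which is prime to `p`.
open Polynomial in
theorem exists_eval_sumIDeriv_hermitePoly {S : Finset ℕ} {M ℓ p k : ℕ} (hS : ∀ j ∈ S, j ≤ M)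
    (hp : p.Prime) (hMp : M < p) (hpℓ : p ∣ ℓ) (hℓ : 0 < ℓ) (hk : k ∈ S) :
    ∃ b : ℕ → ℤ, (∀ j ∈ S, (sumIDeriv (hermitePoly S ℓ k)).eval (j : ℤ) =
      ((ℓ - 1).factorial : ℤ) * b j) ∧ (∀ j ∈ S, j ≠ k → (p : ℤ) ∣ b j) ∧ ¬ (p : ℤ) ∣ b k := by
  classical
  obtain ⟨g, -, hg⟩ := eval_sumIDeriv_of_pos (hermitePoly S ℓ k) hℓ
  have hfac : (ℓ.factorial : ℤ) = ((ℓ - 1).factorial : ℤ) * ℓ := by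
    rw [← Nat.mul_factorial_pred hℓ.ne']; push_cast; ring
  have hpℓ' : (p : ℤ) ∣ (ℓ : ℤ) := by exact_mod_cast hpℓ
  refine ⟨fun j => (if j = k then ∏ i ∈ S.erase k, ((k : ℤ) - i) ^ ℓ else 0) +
    ℓ * g.eval (j : ℤ), ?_, ?_, ?_⟩
  · intro j hj
    by_cases hjk : j = k
    · subst hjk
      rw [hg (j : ℤ) (p' := ∏ i ∈ S.erase j, (X - C (i : ℤ)) ^ ℓ) rfl]
      simp only [eval_prod, eval_pow, eval_sub, eval_X, eval_C, nsmul_eq_mul, if_true, hfac]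
      ring
    · have hj' : j ∈ S.erase k := Finset.mem_erase.2 ⟨hjk, hj⟩
      rw [hg (j : ℤ) (p' := (X - C (j : ℤ)) * ((X - C (k : ℤ)) ^ (ℓ - 1) *
        ∏ i ∈ (S.erase k).erase j, (X - C (i : ℤ)) ^ ℓ))]
      · simp only [eval_mul, eval_sub, eval_X, eval_C, nsmul_eq_mul, if_neg hjk, hfac]
        ring
      · rw [hermitePoly, ← Finset.mul_prod_erase _ _ hj']
        conv_lhs => rw [show ℓ = (ℓ - 1) + 1 by omega, pow_succ]
        simp only [show ℓ - 1 + 1 = ℓ by omega]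
        ring
  · intro j _ hjk
    simp only [if_neg hjk, zero_add]
    exact Dvd.dvd.mul_right hpℓ' _
  · simp only [if_true]
    rw [← dvd_sub_right (Dvd.dvd.mul_right hpℓ' (g.eval (k : ℤ))), sub_add_cancel_right, dvd_neg]
    have hp' : Prime (p : ℤ) := Nat.prime_iff_prime_int.1 hp
    rw [hp'.dvd_finsetProd_iff]
    rintro ⟨i, hi, h⟩
    obtain ⟨hik, hi⟩ := Finset.mem_erase.1 hi
    -- Both `k` and `i` lie in `[0, M]` and `M < p`, so `p` divides `k - i` only if `k = i`.
    have h1 := Int.eq_zero_of_abs_lt_dvd (hp'.dvd_of_dvd_pow h) (by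
      have := hS i hi; have := hS k hk; rw [abs_lt]; constructor <;> omega)
    omega

/-- Mod `p` the matrix `b` is diagonal with nonzero entries, so its integer determinant is nonzero,
and it stays nonzero in characteristic zero. -/
theorem exists_sum_mul_intCast_ne_zero {A : Type*} [CommRing A] [IsDomain A] [CharZero A]
    {S : Finset ℕ} {p : ℕ} (hp : p.Prime) (b : ℕ → ℕ → ℤ)
    (h1 : ∀ k ∈ S, ∀ j ∈ S, j ≠ k → (p : ℤ) ∣ b k j) (h2 : ∀ k ∈ S, ¬ (p : ℤ) ∣ b k k)
    (c : ℕ → A) (hc : ∃ j ∈ S, c j ≠ 0) : ∃ k ∈ S, ∑ j ∈ S, (b k j : A) * c j ≠ 0 := by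
  classical
  by_contra! h
  have := Fact.mk hp
  let B : Matrix S S ℤ := Matrix.of fun k j => b k j
  have hB : B.det ≠ 0 := by
    intro h0
    have h3 : ((Int.castRingHom (ZMod p)) B.det) = 0 := by rw [h0]; simp
    rw [RingHom.map_det] at h3
    have h4 : (Int.castRingHom (ZMod p)).mapMatrix B =
        Matrix.diagonal (fun k : S => ((b k k : ℤ) : ZMod p)) := by
      ext k j
      rw [Matrix.diagonal_apply]
      split_ifs with hkj
      · subst hkj; rfl
      · simpa [B] using (ZMod.intCast_zmod_eq_zero_iff_dvd _ p).2
          (h1 k k.2 j j.2 (fun h => hkj (Subtype.ext h.symm)))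
    rw [h4, Matrix.det_diagonal, Finset.prod_eq_zero_iff] at h3
    obtain ⟨k, -, hk⟩ := h3
    exact h2 k k.2 ((ZMod.intCast_zmod_eq_zero_iff_dvd _ p).1 hk)
  have hB' : ((Int.castRingHom A).mapMatrix B).det ≠ 0 := by
    rw [← RingHom.map_det]; simpa using hB
  apply hB'
  rw [← Matrix.exists_mulVec_eq_zero_iff]
  obtain ⟨j, hj, hcj⟩ := hc
  refine ⟨fun j => c j, fun h0 => hcj (congrFun h0 ⟨j, hj⟩), ?_⟩
  ext k
  have := h k k.2
  rw [← Finset.sum_coe_sort] at this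
  simpa [Matrix.mulVec, dotProduct, B, Matrix.map_apply] using this

/-! ### Size estimates for the Hermite polynomials -/

open Polynomial in
theorem eval_zero_sumIDeriv (f : ℤ[X]) {n : ℕ} (hn : f.natDegree ≤ n) :
    (sumIDeriv f).eval 0 = ∑ i ∈ Finset.range (n + 1), (i.factorial : ℤ) * f.coeff i := by
  rw [sumIDeriv_apply_of_le hn, eval_finsetSum]
  refine Finset.sum_congr rfl fun i _ => ?_
  rw [← coeff_zero_eq_eval_zero, coeff_iterate_derivative]
  simp [Nat.descFactorial_self]

open Polynomial in
theorem abs_coeff_mul_le {f f' g g' : ℤ[X]} (hf : ∀ i, |f.coeff i| ≤ g.coeff i)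
    (hf' : ∀ i, |f'.coeff i| ≤ g'.coeff i) (i : ℕ) : |(f * f').coeff i| ≤ (g * g').coeff i := by
  rw [coeff_mul, coeff_mul]
  refine (Finset.abs_sum_le_sum_abs _ _).trans (Finset.sum_le_sum fun x _ => ?_)
  rw [abs_mul]
  exact mul_le_mul (hf _) (hf' _) (abs_nonneg _) ((abs_nonneg _).trans (hf _))

open Polynomial in
theorem abs_coeff_pow_le {f g : ℤ[X]} (hf : ∀ i, |f.coeff i| ≤ g.coeff i) (m i : ℕ) :
    |(f ^ m).coeff i| ≤ (g ^ m).coeff i := by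
  induction m generalizing i with
  | zero => simp only [pow_zero, coeff_one]; split_ifs <;> simp
  | succ m ih => rw [pow_succ, pow_succ]; exact abs_coeff_mul_le ih hf i

open Polynomial in
theorem abs_coeff_prod_le {ι : Type*} (s : Finset ι) {f g : ι → ℤ[X]}
    (hf : ∀ j ∈ s, ∀ i, |(f j).coeff i| ≤ (g j).coeff i) (i : ℕ) :
    |(∏ j ∈ s, f j).coeff i| ≤ (∏ j ∈ s, g j).coeff i := by
  classical
  induction s using Finset.induction_on generalizing i with
  | empty => simp only [Finset.prod_empty, coeff_one]; split_ifs <;> simp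
  | insert a s ha ih =>
    rw [Finset.prod_insert ha, Finset.prod_insert ha]
    exact abs_coeff_mul_le (hf a (Finset.mem_insert_self _ _))
      (ih fun j hj => hf j (Finset.mem_insert_of_mem hj)) i

theorem card_mul_sub_one {S : Finset ℕ} {ℓ k : ℕ} (hℓ : 0 < ℓ) (hk : k ∈ S) :
    S.card * ℓ - 1 = (ℓ - 1) + ℓ * (S.erase k).card := by
  rw [← Finset.card_erase_add_one hk, add_mul, one_mul, mul_comm ℓ, Nat.add_sub_assoc hℓ, add_comm]

open Polynomial in
theorem abs_coeff_hermitePoly_le {S : Finset ℕ} {M ℓ k : ℕ} (hS : ∀ j ∈ S, j ≤ M) (hℓ : 0 < ℓ)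
    (hk : k ∈ S) (i : ℕ) :
    |(hermitePoly S ℓ k).coeff i| ≤ ((X + C (M : ℤ)) ^ (S.card * ℓ - 1)).coeff i := by
  have key : ∀ j ∈ S, ∀ i, |(X - C (j : ℤ)).coeff i| ≤ (X + C (M : ℤ)).coeff i := by
    intro j hj i
    have := hS j hj
    rcases i with _ | _ | i
    · simpa using this
    · simp
    · simp [coeff_X]
  rw [card_mul_sub_one hℓ hk, pow_add, pow_mul, ← Finset.prod_const]
  exact abs_coeff_mul_le (abs_coeff_pow_le (key k hk) _)
    (abs_coeff_prod_le _ fun j hj => abs_coeff_pow_le (key j (Finset.mem_of_mem_erase hj)) _) i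

-- The value at 0 is `∑ i! f_i`. The coefficients are majorized by those of `(x + M)^D`, and `i! (D
-- choose i) = D! / (D-i)!` turns the sum into `D!` times a partial sum of the series of `e^M`.
open Polynomial in
theorem abs_eval_zero_sumIDeriv_le {f : ℤ[X]} {M D : ℕ}
    (hf : ∀ i, |f.coeff i| ≤ ((X + C (M : ℤ)) ^ D).coeff i) :
    |(((sumIDeriv f).eval 0 : ℤ) : ℝ)| ≤ D.factorial * Real.exp M := by
  have hdeg : f.natDegree ≤ D := by
    refine natDegree_le_iff_coeff_eq_zero.2 fun i hi => ?_
    have := hf i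
    rw [coeff_eq_zero_of_natDegree_lt (p := (X + C (M : ℤ)) ^ D)
      (by rwa [natDegree_pow, natDegree_X_add_C, mul_one])] at this
    exact abs_nonpos_iff.1 this
  rw [eval_zero_sumIDeriv f hdeg]
  push_cast
  calc |∑ i ∈ Finset.range (D + 1), (i.factorial : ℝ) * (f.coeff i : ℝ)|
      ≤ ∑ i ∈ Finset.range (D + 1), (i.factorial : ℝ) * ((M : ℝ) ^ (D - i) * D.choose i) := by
        refine (Finset.abs_sum_le_sum_abs _ _).trans (Finset.sum_le_sum fun i _ => ?_)
        rw [abs_mul, Nat.abs_cast]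
        refine mul_le_mul_of_nonneg_left ?_ (Nat.cast_nonneg _)
        have := hf i
        rw [coeff_X_add_C_pow] at this
        exact_mod_cast this
    _ = ∑ i ∈ Finset.range (D + 1), (D.factorial : ℝ) * ((M : ℝ) ^ (D - i) / (D - i).factorial) := by
        refine Finset.sum_congr rfl fun i hi => ?_
        have hi' : i ≤ D := Nat.lt_succ_iff.1 (Finset.mem_range.1 hi)
        have h := Nat.choose_mul_factorial_mul_factorial hi'
        have h' : (D.choose i : ℝ) * i.factorial * (D - i).factorial = D.factorial := by
          exact_mod_cast h
        have : ((D - i).factorial : ℝ) ≠ 0 := by positivity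
        rw [← h']
        field_simp
    _ = (D.factorial : ℝ) * ∑ i ∈ Finset.range (D + 1), (M : ℝ) ^ i / i.factorial := by
        rw [← Finset.mul_sum]
        congr 1
        exact Finset.sum_range_reflect (fun i => (M : ℝ) ^ i / i.factorial) (D + 1)
    _ ≤ _ := by gcongr; exact Real.sum_le_exp_of_nonneg (by positivity) _

-- With `F = sumIDeriv f` one has `F - F' = f`, so `-e^(-u) F(u)` has derivative `e^(-u) f(u)`, and
-- the mean value inequality on `[0, b]` applies.
open Polynomial in
theorem abs_exp_mul_eval_sumIDeriv_sub_le (f : ℝ[X]) {b B : ℝ} (hb : 0 ≤ b)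
    (hB : ∀ u ∈ Set.Icc 0 b, |f.eval u| ≤ B) :
    |Real.exp b * (sumIDeriv f).eval 0 - (sumIDeriv f).eval b| ≤ Real.exp b * (B * b) := by
  have hder : ∀ u ∈ Set.Icc 0 b, HasDerivWithinAt
      (fun u => -(Real.exp (-u) * (sumIDeriv f).eval u)) (Real.exp (-u) * f.eval u)
      (Set.Icc 0 b) u := by
    intro u _
    have h₁ := ((hasDerivAt_id' u).fun_neg.exp)
    have h₂ := (sumIDeriv f).hasDerivAt u
    have h₃ := (h₁.mul h₂).fun_neg
    refine HasDerivAt.hasDerivWithinAt ?_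
    convert! h₃ using 1
    nth_rw 1 [sumIDeriv_eq_self_add f]
    simp only [eval_add]
    ring
  have h := Convex.norm_image_sub_le_of_norm_hasDerivWithin_le (C := B) hder (fun u hu => by
    rw [norm_mul, Real.norm_eq_abs, Real.norm_eq_abs, Real.abs_exp]
    have h1 : Real.exp (-u) ≤ 1 := Real.exp_le_one_iff.2 (by linarith [hu.1])
    calc Real.exp (-u) * |f.eval u| ≤ 1 * B :=
          mul_le_mul h1 (hB u hu) (abs_nonneg _) zero_le_one
      _ = B := one_mul B) (convex_Icc 0 b) (Set.left_mem_Icc.2 hb) (Set.right_mem_Icc.2 hb)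
  rw [Real.norm_eq_abs, Real.norm_eq_abs, sub_zero, abs_of_nonneg hb] at h
  have : Real.exp b * (sumIDeriv f).eval 0 - (sumIDeriv f).eval b = Real.exp b *
      (-(Real.exp (-b) * (sumIDeriv f).eval b) - -(Real.exp (-0) * (sumIDeriv f).eval 0)) := by
    have : Real.exp b * Real.exp (-b) = 1 := by rw [← Real.exp_add]; simp
    simp only [neg_zero, Real.exp_zero]
    linear_combination (eval b (sumIDeriv f)) * this
  rw [this, abs_mul, Real.abs_exp]
  exact mul_le_mul_of_nonneg_left h (Real.exp_nonneg _)

open Polynomial in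
theorem abs_eval_hermitePoly_le {S : Finset ℕ} {M ℓ k : ℕ} (hS : ∀ j ∈ S, j ≤ M) (hℓ : 0 < ℓ)
    (hk : k ∈ S) {u : ℝ} (hu : u ∈ Set.Icc (0 : ℝ) M) :
    |((hermitePoly S ℓ k).map (Int.castRingHom ℝ)).eval u| ≤ (M : ℝ) ^ (S.card * ℓ - 1) := by
  have key : ∀ j ∈ S, |u - (j : ℝ)| ≤ M := by
    intro j hj
    have : (j : ℝ) ≤ M := by exact_mod_cast hS j hj
    have : (0 : ℝ) ≤ j := by positivity
    rw [abs_le]; constructor <;> linarith [hu.1, hu.2]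
  rw [card_mul_sub_one hℓ hk, pow_add, pow_mul, ← Finset.prod_const]
  simp only [hermitePoly, Polynomial.map_mul, Polynomial.map_pow, Polynomial.map_sub, map_X,
    Polynomial.map_prod, map_natCast, Polynomial.map_natCast, eval_mul, eval_pow, eval_sub, eval_X,
    eval_prod, eval_natCast, abs_mul, abs_pow, Finset.abs_prod]
  refine mul_le_mul (pow_le_pow_left₀ (abs_nonneg _) (key k hk) _) ?_ (by positivity) (by positivity)
  exact Finset.prod_le_prod (fun _ _ => by positivity)
    fun j hj => pow_le_pow_left₀ (abs_nonneg _) (key j (Finset.mem_of_mem_erase hj)) _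

/-! ### The basic inequality for P(e) -/

/-- There is only one infinite place, so the condition on the other places is vacuous. -/
theorem one_le_norm_of_finrank_eq_two {K : Type*} [Field K] [NumberField K]
    [NumberField.IsTotallyComplex K] (hK : Module.finrank ℚ K = 2) (σ : K →+* ℂ) {z : 𝓞 K}
    (hz : z ≠ 0) : 1 ≤ ‖σ z‖ := by
  have hcard : Fintype.card (NumberField.InfinitePlace K) = 1 := by
    have h1 := NumberField.InfinitePlace.card_eq_nrRealPlaces_add_nrComplexPlaces K
    have h2 := NumberField.InfinitePlace.card_add_two_mul_card_eq_rank K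
    have h3 := NumberField.IsTotallyComplex.nrRealPlaces_eq_zero K
    omega
  have := Fintype.card_le_one_iff_subsingleton.1 hcard.le
  have h := NumberField.InfinitePlace.one_le_of_lt_one (w := NumberField.InfinitePlace.mk σ) hz
    fun w hw => absurd (Subsingleton.elim _ _) hw
  simpa using h

open Polynomial in
theorem norm_exp_mul_sub_le {S : Finset ℕ} {M ℓ k j : ℕ} (hS : ∀ j ∈ S, j ≤ M) (hℓ : 0 < ℓ)
    (hk : k ∈ S) (hj : j ∈ S) :
    ‖Complex.exp 1 ^ j * ((sumIDeriv (hermitePoly S ℓ k)).eval 0 : ℤ) -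
      ((sumIDeriv (hermitePoly S ℓ k)).eval (j : ℤ) : ℤ)‖ ≤
      Real.exp M * (M : ℝ) ^ (S.card * ℓ) := by
  have hjM : (j : ℝ) ≤ M := by exact_mod_cast hS j hj
  have h := abs_exp_mul_eval_sumIDeriv_sub_le ((hermitePoly S ℓ k).map (Int.castRingHom ℝ))
    (b := j) (B := (M : ℝ) ^ (S.card * ℓ - 1)) (Nat.cast_nonneg _)
    fun u hu => abs_eval_hermitePoly_le hS hℓ hk ⟨hu.1, hu.2.trans hjM⟩
  have e1 : ∀ i : ℤ, (sumIDeriv ((hermitePoly S ℓ k).map (Int.castRingHom ℝ))).eval (i : ℝ) =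
      (((sumIDeriv (hermitePoly S ℓ k)).eval i : ℤ) : ℝ) := by
    intro i
    rw [sumIDeriv_map]
    simp
  have e2 := e1 0
  have e3 := e1 j
  rw [Int.cast_zero] at e2
  rw [Int.cast_natCast] at e3
  rw [e2, e3] at h
  have hN : S.card * ℓ - 1 + 1 = S.card * ℓ :=
    Nat.sub_add_cancel (Nat.mul_pos (Finset.card_pos.2 ⟨k, hk⟩) hℓ)
  have e4 : Complex.exp 1 ^ j * ((sumIDeriv (hermitePoly S ℓ k)).eval 0 : ℤ) -
      ((sumIDeriv (hermitePoly S ℓ k)).eval (j : ℤ) : ℤ) =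
      ((Real.exp j * ((sumIDeriv (hermitePoly S ℓ k)).eval 0 : ℤ) -
      ((sumIDeriv (hermitePoly S ℓ k)).eval (j : ℤ) : ℤ) : ℝ) : ℂ) := by
    push_cast
    rw [← Complex.exp_nat_mul, mul_one]
  rw [e4, Complex.norm_real, Real.norm_eq_abs]
  refine h.trans ?_
  conv_rhs => rw [← hN, pow_succ]
  gcongr

open Polynomial in
theorem factorial_le_norm_sum_mul_exp {K : Type*} [Field K] [NumberField K]
    [NumberField.IsTotallyComplex K] (hK : Module.finrank ℚ K = 2) (σ : K →+* ℂ) {S : Finset ℕ}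
    {M ℓ p : ℕ} (hS : ∀ j ∈ S, j ≤ M) (h0 : 0 ∈ S) (hp : p.Prime) (hMp : M < p) (hpℓ : p ∣ ℓ)
    (hℓ : 0 < ℓ) (c : ℕ → 𝓞 K) (hc : ∃ j ∈ S, c j ≠ 0) {H : ℝ}
    (hcH : ∀ j ∈ S, j ≠ 0 → ‖σ (c j)‖ ≤ H)
    (hH : 2 * ((S.card - 1 : ℕ) * H * (Real.exp M * (M : ℝ) ^ (S.card * ℓ))) ≤
      (ℓ - 1).factorial) :
    ((ℓ - 1).factorial : ℝ) ≤ 2 * (‖∑ j ∈ S, σ (c j) * Complex.exp 1 ^ j‖ *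
      ((S.card * ℓ - 1).factorial * Real.exp M)) := by
  choose! b hb1 hb2 hb3 using fun k (hk : k ∈ S) =>
    exists_eval_sumIDeriv_hermitePoly hS hp hMp hpℓ hℓ hk
  obtain ⟨k, hk, hne⟩ := exists_sum_mul_intCast_ne_zero hp b hb2 hb3 c hc
  set F : ℕ → ℤ := fun j => (sumIDeriv (hermitePoly S ℓ k)).eval (j : ℤ) with hF
  have hF0 : (sumIDeriv (hermitePoly S ℓ k)).eval 0 = F 0 := by simp [hF]
  have h1 : (1 : ℝ) ≤ ‖∑ j ∈ S, (b k j : ℂ) * σ (c j)‖ := by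
    simpa using one_le_norm_of_finrank_eq_two hK σ hne
  have h2 : ∑ j ∈ S, σ (c j) * (F j : ℂ) =
      ((ℓ - 1).factorial : ℂ) * ∑ j ∈ S, (b k j : ℂ) * σ (c j) := by
    rw [Finset.mul_sum]
    refine Finset.sum_congr rfl fun j hj => ?_
    simp only [hF]
    rw [hb1 k hk j hj]
    push_cast
    ring
  have h3 : ‖∑ j ∈ S, σ (c j) * (Complex.exp 1 ^ j * (F 0 : ℂ) - F j)‖ ≤
      (S.card - 1 : ℕ) * H * (Real.exp M * (M : ℝ) ^ (S.card * ℓ)) := by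
    -- The term `j = 0` vanishes because `e^0 F(0) - F(0) = 0`; hence no bound on the constant
    -- coefficient is needed.
    rw [← Finset.add_sum_erase _ _ h0]
    simp only [pow_zero, one_mul, sub_self, mul_zero, zero_add]
    refine (norm_sum_le _ _).trans ?_
    rw [← Finset.card_erase_of_mem h0, mul_assoc, ← nsmul_eq_mul]
    refine Finset.sum_le_card_nsmul _ _ _ fun j hj => ?_
    obtain ⟨hj0, hj⟩ := Finset.mem_erase.1 hj
    rw [norm_mul]
    have := norm_exp_mul_sub_le hS hℓ hk hj
    rw [hF0] at this
    exact mul_le_mul (hcH j hj hj0) this (norm_nonneg _) ((norm_nonneg _).trans (hcH j hj hj0))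
  have h4 : (F 0 : ℂ) * ∑ j ∈ S, σ (c j) * Complex.exp 1 ^ j =
      ∑ j ∈ S, σ (c j) * (F j : ℂ) +
        ∑ j ∈ S, σ (c j) * (Complex.exp 1 ^ j * (F 0 : ℂ) - F j) := by
    rw [Finset.mul_sum, ← Finset.sum_add_distrib]
    exact Finset.sum_congr rfl fun j _ => by ring
  have h5 : |(F 0 : ℝ)| ≤ (S.card * ℓ - 1).factorial * Real.exp M := by
    rw [← hF0]
    exact abs_eval_zero_sumIDeriv_le (abs_coeff_hermitePoly_le hS hℓ hk)
  have h6 : ((ℓ - 1).factorial : ℝ) ≤ ‖∑ j ∈ S, σ (c j) * (F j : ℂ)‖ := by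
    rw [h2, norm_mul, Complex.norm_natCast]
    exact le_mul_of_one_le_right (Nat.cast_nonneg _) h1
  have h7 : ‖(F 0 : ℂ) * ∑ j ∈ S, σ (c j) * Complex.exp 1 ^ j‖ ≤
      ‖∑ j ∈ S, σ (c j) * Complex.exp 1 ^ j‖ * ((S.card * ℓ - 1).factorial * Real.exp M) := by
    rw [norm_mul, mul_comm, Complex.norm_intCast]
    gcongr
  have h8 : ‖∑ j ∈ S, σ (c j) * (F j : ℂ)‖ ≤ ‖(F 0 : ℂ) * ∑ j ∈ S, σ (c j) * Complex.exp 1 ^ j‖ +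
      ‖∑ j ∈ S, σ (c j) * (Complex.exp 1 ^ j * (F 0 : ℂ) - F j)‖ := by
    rw [h4]
    exact norm_le_add_norm_add _ _
  linarith

/-! ### The choice of ℓ and the lower bound in terms of A -/

theorem factorial_add_le_mul_pow (m k : ℕ) : (m + k).factorial ≤ m.factorial * (m + k) ^ k := by
  rw [← Nat.factorial_mul_ascFactorial]
  exact Nat.mul_le_mul_left _ (Nat.ascFactorial_le_pow_add m k)

theorem factorial_mul_le (N ℓ : ℕ) :
    (N * ℓ).factorial ≤ N ^ (N * ℓ) * ℓ.factorial ^ N := by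
  induction ℓ with
  | zero => simp
  | succ ℓ ih =>
    rw [mul_add, mul_one]
    calc (N * ℓ + N).factorial ≤ (N * ℓ).factorial * (N * ℓ + N) ^ N :=
          factorial_add_le_mul_pow _ _
      _ ≤ (N ^ (N * ℓ) * ℓ.factorial ^ N) * (N * ℓ + N) ^ N := Nat.mul_le_mul_right _ ih
      _ = N ^ (N * ℓ + N) * (ℓ + 1).factorial ^ N := by
        rw [Nat.factorial_succ, mul_pow, pow_add, show N * ℓ + N = N * (ℓ + 1) by ring, mul_pow]
        ring

/-- Take `t` minimal. Failure at `t - 1` bounds `(q(t-1))!`, and passing to `(qt+1)!` costs `q + 1`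
factors, each at most `qt + 1`. The value `t = 0` is excluded by `Y T > 1`. -/
theorem exists_factorial_ge_and_le {q t₀ : ℕ} {Y T : ℝ} (hY : 1 < Y) (hT : 1 ≤ T)
    (h : Y * T ^ (q * t₀ + 1) ≤ (q * t₀).factorial) :
    ∃ t ≤ t₀, Y * T ^ (q * t + 1) ≤ (q * t).factorial ∧ 0 < t ∧
      ((q * t + 1).factorial : ℝ) ≤ Y * T ^ (q * t + 1) * (q * t + 1 : ℕ) ^ (q + 1) := by
  classical
  have hex : ∃ t, Y * T ^ (q * t + 1) ≤ (q * t).factorial := ⟨t₀, h⟩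
  have hspec := Nat.find_spec hex
  have hpos : 0 < Nat.find hex := by
    refine Nat.pos_of_ne_zero fun h0 => ?_
    rw [h0] at hspec
    have : Y * T ^ (q * 0 + 1) ≤ 1 := by simpa using hspec
    have : 1 < Y * T ^ (q * 0 + 1) := by
      simp only [mul_zero, zero_add, pow_one]
      nlinarith
    linarith
  refine ⟨Nat.find hex, Nat.find_min' hex h, hspec, hpos, ?_⟩
  obtain ⟨t, ht⟩ := Nat.exists_eq_add_of_le' hpos
  have hmin := Nat.find_min hex (m := t) (by omega)
  rw [not_le] at hmin
  rw [ht]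
  have h1 : q * (t + 1) + 1 = q * t + (q + 1) := by ring
  have h2 := factorial_add_le_mul_pow (q * t) (q + 1)
  simp only [Nat.succ_eq_add_one, zero_add]
  rw [h1]
  calc ((q * t + (q + 1)).factorial : ℝ)
      ≤ (q * t).factorial * ((q * t + (q + 1) : ℕ) : ℝ) ^ (q + 1) := by exact_mod_cast h2
    _ ≤ _ := by
      gcongr
      refine hmin.le.trans ?_
      gcongr
      omega

theorem mul_log_sub_one_le_log_factorial {k : ℕ} (hk : 0 < k) :
    (k : ℝ) * (Real.log k - 1) ≤ Real.log k.factorial := by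
  have h := Stirling.le_log_factorial_stirling hk.ne'
  have h1 : (1 : ℝ) ≤ k := by exact_mod_cast hk
  have h2 := Real.log_nonneg h1
  have h3 : 0 ≤ Real.log (2 * Real.pi) := Real.log_nonneg (by nlinarith [Real.pi_gt_three])
  linarith

/-- No prime up to `M` divides `M! t + 1`. So `ℓ` can be taken from an arithmetic progression, at
the price of steps of length `M!`. -/
theorem exists_prime_dvd_factorial_mul_add_one {M t : ℕ} (ht : 0 < t) :
    ∃ p, p.Prime ∧ M < p ∧ p ∣ M.factorial * t + 1 := by
  have h1 : M.factorial * t + 1 ≠ 1 := by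
    have := Nat.mul_pos M.factorial_pos ht
    omega
  refine ⟨_, Nat.minFac_prime h1, ?_, Nat.minFac_dvd _⟩
  by_contra! hle
  have h2 := Nat.minFac_prime h1
  exact h2.one_lt.ne' (Nat.dvd_one.1 ((Nat.dvd_add_right
    (((Nat.Prime.dvd_factorial h2).2 hle).mul_right t)).1 (Nat.minFac_dvd _)))

/-- Linear bookkeeping for the logarithms: `v` stands for `log |P(e)|`, `w` for `log ℓ!`, `r` for
`log (n+1)`, `X` for `log H`, `L` for `log M`. The main terms cost `(n+1)² L A`, and the small terms
`m + a + b` one further `(n+1) L A`. -/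
theorem neg_sub_lt_of_log_bounds {n ℓ A L X m a b r r' v w : ℝ} (hn : 0 ≤ n) (hℓ : 0 ≤ ℓ)
    (hℓA : ℓ ≤ A) (hL : 0 ≤ L) (hb : 0 ≤ b) (hr : 0 ≤ r) (hrL : r ≤ L) (hra : r' ≤ a)
    (hv : 0 ≤ r' + (v + ((n + 1) * ℓ * r + n * w + m)))
    (hw : w ≤ a + X + m + (n + 1) * ℓ * L + b) (h : m + a + b < L * A) :
    -(n * X) - (n + 1) * (n + 2) * L * A < v := by
  have hA : 0 ≤ A := hℓ.trans hℓA
  have g1 : (n + 1) * ℓ * r ≤ (n + 1) * (A * L) := by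
    rw [mul_assoc]
    gcongr
  have g2 : ℓ * L ≤ A * L := by gcongr
  have g3 : n * w ≤ n * (a + X + m + (n + 1) * (A * L) + b) := by
    refine mul_le_mul_of_nonneg_left (hw.trans ?_) hn
    nlinarith
  have g4 : (n + 1) * (m + a + b) < (n + 1) * (L * A) := by gcongr
  linarith

set_option maxHeartbeats 400000 in
-- `hA₁` is the logarithmic form of the condition that an admissible `ℓ ≤ A` exists, and `hA₂`
-- absorbs the lower-order terms.
theorem rpow_lt_norm_sum_mul_exp {K : Type*} [Field K] [NumberField K]
    [NumberField.IsTotallyComplex K] (hK : Module.finrank ℚ K = 2) (σ : K →+* ℂ) {S : Finset ℕ}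
    {M n : ℕ} (hS : ∀ j ∈ S, j ≤ M) (h0 : 0 ∈ S) (hn : 0 < n) (hcard : S.card = n + 1)
    (hnM : n + 1 ≤ M) (c : ℕ → 𝓞 K) (hc : ∃ j ∈ S, c j ≠ 0) {H A : ℝ} (hH : 1 < H)
    (hcH : ∀ j ∈ S, j ≠ 0 → ‖σ (c j)‖ ≤ H) (hA : 1 + (M.factorial : ℝ) < A)
    (hA₁ : ∀ u, A - 1 - M.factorial ≤ u → u ≤ A →
      Real.log H + M + Real.log (2 * M) + M * Real.log M ≤ u * (Real.log u - 1 - M * Real.log M))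
    (hA₂ : M + Real.log (2 * M) + (M.factorial + 1) * Real.log A < Real.log M * A) :
    H ^ (-(n : ℝ) - ((n : ℝ) + 1) * (n + 2) * Real.log M * A / Real.log H) <
      ‖∑ j ∈ S, σ (c j) * Complex.exp 1 ^ j‖ := by
  set X := Real.log H with hX
  set L := Real.log M with hL
  have hXpos : 0 < X := Real.log_pos hH
  have hM1 : (1 : ℝ) ≤ M := by exact_mod_cast (by omega : 1 ≤ M)
  have hn1 : (1 : ℝ) ≤ n := by exact_mod_cast hn
  have hnM' : (n : ℝ) + 1 ≤ M := by exact_mod_cast hnM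
  have hLnn : 0 ≤ L := Real.log_nonneg hM1
  have hq : (0 : ℝ) < M.factorial := by positivity
  -- The largest `t` with `M! t + 1 ≤ A`; then `u = M! t₀` lies in the window of `hA₁`.
  set t₀ := ⌊(A - 1) / M.factorial⌋₊ with ht₀
  have hu1 : (M.factorial : ℝ) * t₀ ≤ A - 1 := by
    have := Nat.floor_le (a := (A - 1) / M.factorial) (div_nonneg (by linarith) hq.le)
    rw [le_div_iff₀ hq] at this
    linarith
  have hu2 : A - 1 - M.factorial < (M.factorial : ℝ) * t₀ := by
    have := Nat.lt_floor_add_one ((A - 1) / (M.factorial : ℝ))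
    rw [div_lt_iff₀ hq] at this
    linarith
  have hupos : 0 < M.factorial * t₀ := by
    have : (0 : ℝ) < (M.factorial : ℝ) * t₀ := by linarith
    exact_mod_cast this
  set Y := 2 * (n * H * Real.exp M) with hYdef
  have hY : 1 < Y := by
    have : 1 < n * H * Real.exp M := by
      have := Real.one_le_exp (x := (M : ℝ)) (by linarith)
      have : 1 < n * H := by nlinarith
      nlinarith
    linarith
  have hT : (1 : ℝ) ≤ (M : ℝ) ^ (n + 1) := one_le_pow₀ hM1
  have hlogY : Real.log Y = Real.log (2 * n) + X + M := by
    rw [hYdef, show 2 * (n * H * Real.exp M) = 2 * n * H * Real.exp M by ring,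
      Real.log_mul (by positivity) (Real.exp_pos _).ne', Real.log_mul (by positivity) (by positivity),
      Real.log_exp]
  have hlog2n : Real.log (2 * n) ≤ Real.log (2 * M) :=
    Real.log_le_log (by positivity) (by linarith)
  have hinit : Y * ((M : ℝ) ^ (n + 1)) ^ (M.factorial * t₀ + 1) ≤
      (M.factorial * t₀).factorial := by
    rw [← Real.log_le_log_iff (by positivity) (by positivity),
      Real.log_mul (by positivity) (by positivity), Real.log_pow, Real.log_pow, hlogY]
    refine le_trans ?_ (mul_log_sub_one_le_log_factorial hupos)
    push_cast
    have h1 := hA₁ (M.factorial * t₀) hu2.le (by linarith)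
    have h2 : ((M.factorial : ℝ) * t₀ + 1) * ((n + 1) * L) ≤ (M.factorial * t₀ + 1) * (M * L) := by
      gcongr
    rw [← hL]
    nlinarith
  obtain ⟨t, htt, ht1, htpos, ht2⟩ := exists_factorial_ge_and_le hY hT hinit
  obtain ⟨p, hp, hMp, hpt⟩ := exists_prime_dvd_factorial_mul_add_one (M := M) htpos
  set ℓ := M.factorial * t + 1 with hℓ
  have hℓ1 : ℓ - 1 = M.factorial * t := by omega
  have hℓA : (ℓ : ℝ) ≤ A := by
    have : (t : ℝ) ≤ t₀ := by exact_mod_cast htt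
    have : (M.factorial : ℝ) * t ≤ M.factorial * t₀ := by gcongr
    rw [hℓ]
    push_cast
    linarith
  have hℓpos : (0 : ℝ) < ℓ := by positivity
  have hmain := factorial_le_norm_sum_mul_exp hK σ hS h0 hp hMp hpt (Nat.succ_pos _) c hc hcH
    (by
      rw [hcard, pow_mul, Nat.add_sub_cancel, hℓ1]
      refine le_trans (le_of_eq ?_) ht1
      rw [hYdef]
      ring)
  set P := ‖∑ j ∈ S, σ (c j) * Complex.exp 1 ^ j‖ with hP
  rw [hcard] at hmain
  have hNl : 0 < (n + 1) * ℓ := by positivity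
  have hf1 : (((n + 1) * ℓ).factorial : ℝ) = ((n + 1 : ℝ) * ℓ) * ((n + 1) * ℓ - 1).factorial := by
    rw [← Nat.mul_factorial_pred hNl.ne']
    push_cast
    ring
  have hf2 : (ℓ.factorial : ℝ) = ℓ * (ℓ - 1).factorial := by
    exact_mod_cast (Nat.mul_factorial_pred (Nat.succ_ne_zero _ : ℓ ≠ 0)).symm
  have hf3 : (((n + 1) * ℓ).factorial : ℝ) ≤
      (n + 1 : ℝ) ^ ((n + 1) * ℓ) * (ℓ.factorial : ℝ) ^ (n + 1) := by
    exact_mod_cast factorial_mul_le (n + 1) ℓ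
  have hPnn : 0 ≤ P := norm_nonneg _
  -- Multiplication by `(n+1) ℓ` completes both factorials; bounding `((n+1)ℓ)!` by a power of `ℓ!`
  -- then lets one factor `ℓ!` cancel.
  have hf4 : (ℓ.factorial : ℝ) * 1 ≤ ℓ.factorial *
      (2 * (P * ((n + 1 : ℝ) ^ ((n + 1) * ℓ) * (ℓ.factorial : ℝ) ^ n * Real.exp M))) := by
    calc (ℓ.factorial : ℝ) * 1 ≤ (n + 1 : ℝ) * ℓ.factorial := by
          nlinarith [(Nat.cast_nonneg ℓ.factorial : (0 : ℝ) ≤ ℓ.factorial)]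
      _ = ((n + 1 : ℝ) * ℓ) * (ℓ - 1).factorial := by rw [hf2]; ring
      _ ≤ ((n + 1 : ℝ) * ℓ) * (2 * (P * (((n + 1) * ℓ - 1).factorial * Real.exp M))) := by gcongr
      _ = 2 * (P * (((n + 1) * ℓ).factorial * Real.exp M)) := by rw [hf1]; ring
      _ ≤ 2 * (P * ((n + 1 : ℝ) ^ ((n + 1) * ℓ) * (ℓ.factorial : ℝ) ^ (n + 1) * Real.exp M)) := by
        gcongr
      _ = _ := by ring
  have hf5 := le_of_mul_le_mul_left hf4 (by positivity)
  have hPpos : 0 < P := by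
    refine hPnn.lt_of_ne fun h => ?_
    rw [← h] at hf5
    norm_num at hf5
  have hv : 0 ≤ Real.log 2 + (Real.log P + ((n + 1) * ℓ * Real.log (n + 1) +
      n * Real.log ℓ.factorial + M)) := by
    have := Real.log_nonneg hf5
    rw [Real.log_mul (by positivity) (by positivity), Real.log_mul (by positivity) (by positivity),
      Real.log_mul (by positivity) (by positivity), Real.log_mul (by positivity) (by positivity),
      Real.log_pow, Real.log_pow, Real.log_exp] at this
    push_cast at this
    exact this
  have hfac : Real.log ℓ.factorial ≤
      Real.log (2 * M) + X + M + (n + 1) * ℓ * L + (M.factorial + 1) * Real.log A := by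
    have h1 := Real.log_le_log (by positivity) ht2
    rw [Real.log_mul (by positivity) (by positivity), Real.log_mul (by positivity) (by positivity),
      hlogY, Real.log_pow, Real.log_pow, Real.log_pow] at h1
    have h2 : Real.log ℓ ≤ Real.log A := Real.log_le_log hℓpos hℓA
    have h3 : ((M.factorial : ℝ) + 1) * Real.log ℓ ≤ (M.factorial + 1) * Real.log A := by gcongr
    push_cast at h1 h3 ⊢
    linarith
  have hlogN : Real.log (n + 1) ≤ L := Real.log_le_log (by positivity) hnM'
  have hlog2 : Real.log 2 ≤ Real.log (2 * M) := Real.log_le_log (by norm_num) (by linarith)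
  have e1 : (-(n : ℝ) - ((n : ℝ) + 1) * (n + 2) * L * A / X) * X =
      -(n * X) - ((n : ℝ) + 1) * (n + 2) * L * A := by
    field_simp
  rw [← Real.log_lt_log_iff (by positivity) hPpos, Real.log_rpow (by linarith), ← hX, e1]
  exact neg_sub_lt_of_log_bounds (Nat.cast_nonneg n) hℓpos.le hℓA hLnn
    (mul_nonneg (by positivity) (Real.log_nonneg (by linarith)))
    (Real.log_nonneg (by linarith)) hlogN hlog2 hv hfac hA₂

/-! ### Comparing M! and powers of M with log H -/

theorem factorial_le_mul_pow_sub_four {M : ℕ} (hM : 4 ≤ M) :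
    M.factorial + 1 ≤ 25 * M ^ (M - 4) := by
  obtain ⟨k, rfl⟩ := Nat.exists_eq_add_of_le hM
  have h := factorial_add_le_mul_pow 4 k
  rw [Nat.add_sub_cancel_left]
  have h1 : 1 ≤ (4 + k) ^ k := Nat.one_le_pow _ _ (by omega)
  have h2 : Nat.factorial 4 = 24 := rfl
  rw [h2] at h
  omega

theorem le_log_natCast {M : ℕ} (hM : 4 ≤ M) : 1.386 ≤ Real.log M := by
  have h1 : Real.log 4 ≤ Real.log M := Real.log_le_log (by norm_num) (by exact_mod_cast hM)
  have h2 : Real.log 4 = 2 * Real.log 2 := by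
    rw [show (4 : ℝ) = 2 ^ 2 by norm_num, Real.log_pow]; norm_num
  linarith [Real.log_two_gt_d9]

theorem mul_log_sq_add_two_le {M : ℕ} (hM : 4 ≤ M) :
    (M : ℝ) * Real.log M ^ 2 + 2 ≤ (M : ℝ) ^ 2 := by
  have hM' : (4 : ℝ) ≤ M := by exact_mod_cast hM
  set r := Real.sqrt M with hr
  have hr2 : r ^ 2 = M := Real.sq_sqrt (by linarith)
  have hr4 : 2 ≤ r := Real.le_sqrt_of_sq_le (by norm_num; linarith)
  -- Tangent line of the logarithm at `r = 2`, that is `M = 4`: `2 log r ≤ r - 2 + 2 log 2`.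
  have hlog : Real.log M ≤ r - 0.6 := by
    have h1 : Real.log (r / 2) ≤ r / 2 - 1 := Real.log_le_sub_one_of_pos (by linarith)
    rw [Real.log_div (by linarith) (by norm_num)] at h1
    have h2 : Real.log M = 2 * Real.log r := by rw [← hr2, Real.log_pow]; norm_num
    linarith [Real.log_two_lt_d9]
  have hL := le_log_natCast hM
  have h3 : Real.log M ^ 2 ≤ (r - 0.6) ^ 2 := by gcongr
  have h4 : (M : ℝ) * Real.log M ^ 2 ≤ M * (r - 0.6) ^ 2 := by gcongr
  have h5 : (M : ℝ) * (1.2 * r - 0.36) ≥ 4 * (1.2 * 2 - 0.36) := by gcongr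
  nlinarith

theorem pow_succ_le_exp {M : ℕ} (hM : 4 ≤ M) :
    (M : ℝ) ^ (M + 1) ≤ Real.exp (M * Real.log M ^ 2) := by
  have hM' : (4 : ℝ) ≤ M := by exact_mod_cast hM
  have hL := le_log_natCast hM
  rw [← Real.log_le_log_iff (by positivity) (Real.exp_pos _), Real.log_pow, Real.log_exp]
  push_cast
  have : (1 : ℝ) ≤ M * (Real.log M - 1) := by nlinarith
  nlinarith

theorem mul_factorial_mul_le_exp {M : ℕ} (hM : 4 ≤ M) {k : ℝ} (hk : 0 ≤ k)
    (hkM : 25 * k ≤ (M : ℝ) ^ 3) :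
    k * (M.factorial + 1) * (M * Real.log M ^ 2 + 2) ≤ Real.exp (M * Real.log M ^ 2) := by
  have h1 : (M.factorial : ℝ) + 1 ≤ 25 * (M : ℝ) ^ (M - 4) := by
    exact_mod_cast factorial_le_mul_pow_sub_four hM
  calc k * (M.factorial + 1) * (M * Real.log M ^ 2 + 2)
      ≤ k * (25 * (M : ℝ) ^ (M - 4)) * (M : ℝ) ^ 2 := by
        gcongr
        exact mul_log_sq_add_two_le hM
    _ = (25 * k) * (M : ℝ) ^ (M - 4) * (M : ℝ) ^ 2 := by ring
    _ ≤ (M : ℝ) ^ 3 * (M : ℝ) ^ (M - 4) * (M : ℝ) ^ 2 := by gcongr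
    _ = (M : ℝ) ^ (M + 1) := by rw [← pow_add, ← pow_add]; congr 1; omega
    _ ≤ _ := pow_succ_le_exp hM

/-- With `x = s + w` the factor `e^s` cancels, and `e^w ≥ s` together with `e^w ≥ 1 + w + w²/2`
suffices. It carries the bound on `M!` from `e^s`, `s = M (log M)²`, over to `X = e^x`. -/
theorem mul_mul_exp_le {s x : ℝ} (hs : 1 ≤ s) (hx : s + Real.log s ≤ x) :
    x * (x + 1) * Real.exp s ≤ 4 * (s + 2) * Real.exp x := by
  obtain ⟨w, rfl⟩ : ∃ w, x = s + w := ⟨x - s, by ring⟩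
  have hw : Real.log s ≤ w := by linarith
  have hw0 : 0 ≤ w := (Real.log_nonneg hs).trans hw
  have h1 : s ≤ Real.exp w := by rwa [← Real.log_le_iff_le_exp (by linarith)]
  have h2 := Real.quadratic_le_exp_of_nonneg hw0
  have h3 : (s + w) * (s + w + 1) ≤ 4 * (s + 2) * Real.exp w := by
    nlinarith [mul_le_mul_of_nonneg_left h1 (by linarith : 0 ≤ s),
      mul_le_mul_of_nonneg_left h2 (by linarith : 0 ≤ s), mul_nonneg (by linarith : 0 ≤ s) hw0,
      mul_nonneg (by linarith : 0 ≤ s) (sq_nonneg w)]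
  rw [Real.exp_add]
  have := mul_le_mul_of_nonneg_right h3 (Real.exp_nonneg s)
  linarith

theorem le_of_mul_exp_le {s X : ℝ} (hs : 1 ≤ s) (hX : s * Real.exp s ≤ X) :
    s + Real.log s ≤ Real.log X := by
  have h := Real.log_le_log (by positivity) hX
  rw [Real.log_mul (by positivity) (Real.exp_pos _).ne', Real.log_exp] at h
  linarith

theorem mul_factorial_mul_log_le {M : ℕ} (hM : 4 ≤ M) {k X : ℝ} (hk : 0 ≤ k)
    (hkM : 25 * k ≤ (M : ℝ) ^ 3)
    (hX : (M : ℝ) * Real.log M ^ 2 * Real.exp (M * Real.log M ^ 2) ≤ X) :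
    k * (M.factorial + 1) * (Real.log X * (Real.log X + 1)) ≤ 4 * X := by
  have hM' : (4 : ℝ) ≤ M := by exact_mod_cast hM
  have hL := le_log_natCast hM
  set s := (M : ℝ) * Real.log M ^ 2 with hs
  have hs1 : 1 ≤ s := by nlinarith
  have hXpos : 0 < X := lt_of_lt_of_le (by positivity) hX
  have hx := le_of_mul_exp_le hs1 hX
  have h1 := mul_factorial_mul_le_exp hM hk hkM
  rw [← hs] at h1
  have h2 := mul_mul_exp_le hs1 hx
  rw [Real.exp_log hXpos] at h2
  have hx0 : 0 ≤ Real.log X * (Real.log X + 1) := by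
    have : 0 ≤ Real.log X := by linarith [Real.log_nonneg hs1]
    positivity
  have h3 := mul_le_mul_of_nonneg_right h1 hx0
  have h4 : (s + 2) * (k * (M.factorial + 1) * (Real.log X * (Real.log X + 1))) ≤
      (s + 2) * (4 * X) := by linarith
  exact le_of_mul_le_mul_left h4 (by linarith)

theorem add_log_add_mul_log_le {M : ℕ} (hM : 4 ≤ M) {X : ℝ}
    (hX : (M : ℝ) * Real.log M ^ 2 * Real.exp (M * Real.log M ^ 2) ≤ X) :
    (M : ℝ) ^ 3 * (M + Real.log (2 * M) + M * Real.log M) ≤ 2 * X := by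
  have hM' : (4 : ℝ) ≤ M := by exact_mod_cast hM
  have hL := le_log_natCast hM
  have h1 : Real.log (2 * M) ≤ 2 * M - 1 := Real.log_le_sub_one_of_pos (by positivity)
  have h2 : Real.log M ≤ M - 1 := Real.log_le_sub_one_of_pos (by positivity)
  have h3 : (M : ℝ) + Real.log (2 * M) + M * Real.log M ≤ 2 * (M : ℝ) ^ 2 := by nlinarith
  have hs1 : 1 ≤ (M : ℝ) * Real.log M ^ 2 := by nlinarith
  calc (M : ℝ) ^ 3 * (M + Real.log (2 * M) + M * Real.log M)
      ≤ (M : ℝ) ^ 3 * (2 * (M : ℝ) ^ 2) := by gcongr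
    _ = 2 * (M : ℝ) ^ 5 := by ring
    _ ≤ 2 * (M : ℝ) ^ (M + 1) := by
        gcongr
        · linarith
        · omega
    _ ≤ 2 * Real.exp (M * Real.log M ^ 2) := by
        gcongr
        exact pow_succ_le_exp hM
    _ ≤ 2 * X := by
        gcongr
        refine le_trans ?_ hX
        exact le_mul_of_one_le_left (Real.exp_nonneg _) hs1

theorem le_mul_log_sub {κ X u b δ : ℝ} (hκ : 0 < κ) (hX : 1 < X) (hu : κ * X / Real.log X ≤ u)
    (hb : 0 ≤ Real.log κ + Real.log X - Real.log (Real.log X) - b)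
    (h : (1 + δ) * Real.log X ≤ κ * (Real.log κ + Real.log X - Real.log (Real.log X) - b)) :
    X + δ * X ≤ u * (Real.log u - b) := by
  have hx : 0 < Real.log X := Real.log_pos hX
  have h0 : 0 < κ * X / Real.log X := by positivity
  have h1 := Real.log_le_log h0 hu
  rw [Real.log_div (by positivity) hx.ne', Real.log_mul hκ.ne' (by positivity)] at h1
  calc X + δ * X = X / Real.log X * ((1 + δ) * Real.log X) := by field_simp
    _ ≤ X / Real.log X * (κ * (Real.log κ + Real.log X - Real.log (Real.log X) - b)) := by gcongr
    _ = κ * X / Real.log X * (Real.log κ + Real.log X - Real.log (Real.log X) - b) := by ring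
    _ ≤ u * (Real.log u - b) := by
      gcongr
      exact h0.le.trans hu

/-- Here `A = c X / log X` with `X = log H`. The growth condition is checked with the smaller
constant `κ`; the gap `c - κ` pays for the step length `M! + 1`. The parameter `k` measures how
small `M!` is against `X`, and `2 / M³` covers the terms of `hA₁` that do not involve `H`. -/
theorem sparseBound_lt_norm_sum_mul_exp {K : Type*} [Field K] [NumberField K]
    [NumberField.IsTotallyComplex K] (hK : Module.finrank ℚ K = 2) (σ : K →+* ℂ) {S : Finset ℕ}
    {M n : ℕ} (hS : ∀ j ∈ S, j ≤ M) (h0 : 0 ∈ S) (hn : 0 < n) (hcard : S.card = n + 1)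
    (hM : 4 ≤ M) (hnM : n + 1 ≤ M) (cf : ℕ → 𝓞 K) (hcf : ∃ j ∈ S, cf j ≠ 0) {H : ℝ} (hH0 : 0 < H)
    (hH : (M : ℝ) * Real.log M ^ 2 * Real.exp (M * Real.log M ^ 2) ≤ Real.log H)
    (hcH : ∀ j ∈ S, j ≠ 0 → ‖σ (cf j)‖ ≤ H) {c κ k : ℝ} (hc : 2 ≤ c) (hc' : c ≤ 13) (hk : 0 < k)
    (hkM : 25 * k ≤ (M : ℝ) ^ 3) (hck : 32 ≤ k * c) (hκ : 0 < κ)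
    (hκc : κ + 4 / (k * (M * Real.log M ^ 2)) ≤ c)
    (hmain : ∀ x, M * Real.log M ^ 2 ≤ x →
      (1 + 2 / (M : ℝ) ^ 3) * x ≤ κ * (Real.log κ + x - Real.log x - (1 + M * Real.log M))) :
    sparseBound c n M H < ‖∑ j ∈ S, σ (cf j) * Complex.exp 1 ^ j‖ := by
  have hM' : (4 : ℝ) ≤ M := by exact_mod_cast hM
  have hL := le_log_natCast hM
  have hs : 7.6 ≤ (M : ℝ) * Real.log M ^ 2 := by nlinarith
  have hfac := mul_factorial_mul_log_le hM hk.le hkM hH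
  have hsmall := add_log_add_mul_log_le hM hH
  have hx := le_of_mul_exp_le (by linarith) hH
  have hs0 := Real.log_nonneg (x := (M : ℝ) * Real.log M ^ 2) (by linarith)
  set X := Real.log H with hX
  have hX1 : 1 < X := by
    refine lt_of_lt_of_le ?_ hH
    have := Real.one_le_exp (x := (M : ℝ) * Real.log M ^ 2) (by linarith)
    nlinarith
  have hxs : (M : ℝ) * Real.log M ^ 2 ≤ Real.log X := by linarith
  set x := Real.log X with hxdef
  have hx0 : 0 < x := by linarith
  have hH1 : 1 < H := by
    rw [← Real.log_pos_iff hH0.le, ← hX]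
    linarith
  set A := c * X / x with hA
  have hA0 : 0 < A := by positivity
  have hAx : A * x = c * X := by rw [hA]; field_simp
  have hq : (M : ℝ) ≤ M.factorial := by exact_mod_cast Nat.self_le_factorial M
  have hfacA : ((M.factorial : ℝ) + 1) * (x + 1) ≤ A / 8 := by
    have h1 : x * (32 * (((M.factorial : ℝ) + 1) * (x + 1))) ≤ x * (4 * A) := by
      calc x * (32 * (((M.factorial : ℝ) + 1) * (x + 1)))
          ≤ x * ((k * c) * (((M.factorial : ℝ) + 1) * (x + 1))) := by gcongr
        _ = c * (k * (M.factorial + 1) * (x * (x + 1))) := by ring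
        _ ≤ c * (4 * X) := by gcongr
        _ = x * (4 * A) := by linarith
    have := le_of_mul_le_mul_left h1 hx0
    linarith
  have hqx : ((M.factorial : ℝ) + 1) * 8 ≤ A / 8 := by
    refine le_trans ?_ hfacA
    gcongr
    linarith
  have key := rpow_lt_norm_sum_mul_exp hK σ hS h0 hn hcard hnM cf hcf hH1 hcH (A := A)
    (by linarith) ?_ ?_
  · rw [sparseBound]
    convert key using 3
    rw [← hX, ← hxdef, hA]
    field_simp
    ring
  · intro u hu1 hu2
    have h1 := hmain x hxs
    have hb : 0 ≤ Real.log κ + x - Real.log x - (1 + M * Real.log M) := by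
      have : 0 ≤ κ * (Real.log κ + x - Real.log x - (1 + M * Real.log M)) :=
        le_trans (by positivity) h1
      exact nonneg_of_mul_nonneg_right this hκ
    have hu : κ * X / x ≤ u := by
      refine le_trans ?_ hu1
      have h2 : (M.factorial : ℝ) + 1 ≤ 4 / (k * (M * Real.log M ^ 2)) * (X / x) := by
        have h3 : k * (M * Real.log M ^ 2) * x * (M.factorial + 1) ≤ 4 * X := by
          refine le_trans ?_ hfac
          have : k * (M.factorial + 1) * x * (M * Real.log M ^ 2) ≤
            k * (M.factorial + 1) * x * (x + 1) := by
            gcongr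
            linarith
          linarith
        rw [div_mul_div_comm, le_div_iff₀ (by positivity)]
        linarith
      have h4 : (κ + 4 / (k * (M * Real.log M ^ 2))) * (X / x) ≤ c * (X / x) := by gcongr
      rw [hA, mul_div_assoc, mul_div_assoc]
      linarith
    have h5 := le_mul_log_sub hκ hX1 hu hb h1
    have h6 : (M : ℝ) + Real.log (2 * M) + M * Real.log M ≤ 2 / (M : ℝ) ^ 3 * X := by
      rw [div_mul_eq_mul_div, le_div_iff₀ (by positivity)]
      linarith
    rw [sub_sub]
    linarith
  · have h1 : Real.log A ≤ x + 1 := by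
      rw [hA, mul_div_right_comm, Real.log_mul (by positivity) (by positivity), ← hxdef]
      have := Real.log_le_sub_one_of_pos (x := c / x) (by positivity)
      have : c / x ≤ 2 := by rw [div_le_iff₀ hx0]; linarith
      linarith
    have h2 : ((M.factorial : ℝ) + 1) * Real.log A ≤ A / 8 := le_trans (by gcongr) hfacA
    have h3 : Real.log (2 * M) ≤ 2 * M - 1 := Real.log_le_sub_one_of_pos (by positivity)
    have h4 : 1.386 * A ≤ Real.log M * A := by gcongr
    linarith

/-! ### Numerical verification for the two constants -/

theorem log_le_mul_add {x : ℝ} (hx : 0 < x) {a : ℝ} (ha : 0 < a) :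
    Real.log x ≤ x / a + Real.log a - 1 := by
  have := Real.log_le_sub_one_of_pos (x := x / a) (by positivity)
  rw [Real.log_div hx.ne' ha.ne'] at this
  linarith

theorem one_add_mul_le_mul_log_of_four_le {M : ℕ} (hM : 4 ≤ M) {x : ℝ}
    (hx : M * Real.log M ^ 2 ≤ x) :
    (1 + 2 / (M : ℝ) ^ 3) * x ≤
      12.6 * (Real.log 12.6 + x - Real.log x - (1 + M * Real.log M)) := by
  have hM' : (4 : ℝ) ≤ M := by exact_mod_cast hM
  have hL := le_log_natCast hM
  have hx0 : 0 < x := lt_of_lt_of_le (by positivity) hx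
  have h8 : Real.log 8 = 3 * Real.log 2 := by
    rw [show (8 : ℝ) = 2 ^ 3 by norm_num, Real.log_pow]; norm_num
  -- The tangent point 8 is the power of 2 near `4 (log 4)² ≈ 7.7`, the least value of `x`.
  have h1 := log_le_mul_add hx0 (a := 8) (by norm_num)
  have h2 : 2.4 ≤ Real.log 12.6 := by
    have := log_le_mul_add (x := 8) (a := 12.6) (by norm_num) (by norm_num)
    rw [h8] at this
    norm_num at this ⊢
    linarith [Real.log_two_gt_d9]
  have h3 : 2 / (M : ℝ) ^ 3 ≤ 0.032 := by
    rw [div_le_iff₀ (by positivity)]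
    have : (4 : ℝ) ^ 3 ≤ (M : ℝ) ^ 3 := by gcongr
    linarith
  have h4 : 2 / (M : ℝ) ^ 3 * x ≤ 0.032 * x := by gcongr
  have h5 : (M * Real.log M) * 1.386 ≤ (M * Real.log M) * Real.log M := by gcongr
  have h6 : 0 ≤ M * Real.log M := by positivity
  nlinarith [Real.log_two_lt_d9]

theorem le_log_natCast_of_eleven_le {M : ℕ} (hM : 11 ≤ M) : 2.397 ≤ Real.log M := by
  have h1 : Real.log 11 ≤ Real.log M := Real.log_le_log (by norm_num) (by exact_mod_cast hM)
  -- `11² = 121` is close to `2^7 = 128`, which bounds `log 11` below through `log 2`.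
  have h2 := log_le_mul_add (x := 128) (a := 121) (by norm_num) (by norm_num)
  rw [show (128 : ℝ) = 2 ^ 7 by norm_num, show (121 : ℝ) = 11 ^ 2 by norm_num, Real.log_pow,
    Real.log_pow] at h2
  norm_num at h2 ⊢
  linarith [Real.log_two_gt_d9]

theorem one_add_mul_le_mul_log_of_eleven_le {M : ℕ} (hM : 11 ≤ M) {x : ℝ}
    (hx : M * Real.log M ^ 2 ≤ x) :
    (1 + 2 / (M : ℝ) ^ 3) * x ≤
      1.998 * (Real.log 1.998 + x - Real.log x - (1 + M * Real.log M)) := by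
  have hM' : (11 : ℝ) ≤ M := by exact_mod_cast hM
  have hL := le_log_natCast_of_eleven_le hM
  have hx0 : 0 < x := lt_of_lt_of_le (by positivity) hx
  have h64 : Real.log 64 = 6 * Real.log 2 := by
    rw [show (64 : ℝ) = 2 ^ 6 by norm_num, Real.log_pow]; norm_num
  -- `64` is the power of 2 near `11 (log 11)² ≈ 63.2`, where the inequality has little slack.
  have h1 := log_le_mul_add hx0 (a := 64) (by norm_num)
  have h2 : 0.69 ≤ Real.log 1.998 := by
    have := log_le_mul_add (x := 2) (a := 1.998) (by norm_num) (by norm_num)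
    norm_num at this ⊢
    linarith [Real.log_two_gt_d9]
  have h3 : 2 / (M : ℝ) ^ 3 ≤ 0.0016 := by
    rw [div_le_iff₀ (by positivity)]
    have : (11 : ℝ) ^ 3 ≤ (M : ℝ) ^ 3 := by gcongr
    linarith
  have h4 : 2 / (M : ℝ) ^ 3 * x ≤ 0.0016 * x := by gcongr
  have h5 : (M * Real.log M) * 2.397 ≤ (M * Real.log M) * Real.log M := by gcongr
  have h6 : 11 * 2.397 ≤ M * Real.log M := by gcongr
  nlinarith [Real.log_two_lt_d9]

/-! ### From sparse polynomials to sums over S -/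

open Polynomial in
theorem coeff_sparsePoly {R : Type*} [CommRing R] {m : ℕ} (β : Fin (m + 1) → ℕ)
    (lam : Fin (m + 1) → R) (i : ℕ) :
    (sparsePoly β lam).coeff i = ∑ j, if i = β j then lam j else 0 := by
  simp [sparsePoly, coeff_X_pow]

theorem coeff_sparsePoly_apply {R : Type*} [CommRing R] {m : ℕ} {β : Fin (m + 1) → ℕ}
    (hβ : Function.Injective β) (lam : Fin (m + 1) → R) (j : Fin (m + 1)) :
    (sparsePoly β lam).coeff (β j) = lam j := by
  simp [coeff_sparsePoly, hβ.eq_iff]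

theorem support_sparsePoly_subset {R : Type*} [CommRing R] {m : ℕ} (β : Fin (m + 1) → ℕ)
    (lam : Fin (m + 1) → R) : (sparsePoly β lam).support ⊆ Finset.univ.image β := by
  intro i hi
  by_contra h
  refine Polynomial.mem_support_iff.1 hi ?_
  rw [coeff_sparsePoly]
  refine Finset.sum_eq_zero fun j _ => if_neg fun hij => h ?_
  exact hij ▸ Finset.mem_image_of_mem _ (Finset.mem_univ _)

theorem evalAtE_eq_sum {K : Type*} [Field K] (σ : K →+* ℂ) (P : (𝓞 K)[X]) {S : Finset ℕ}
    (hS : P.support ⊆ S) : evalAtE σ P = ∑ j ∈ S, σ (P.coeff j) * Complex.exp 1 ^ j := by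
  rw [evalAtE, Polynomial.eval₂_def, Polynomial.sum_eq_of_subset _ (by simp) hS]
  rfl

theorem mainTheorem5
    {K : Type*} [Field K] [NumberField K] [NumberField.IsTotallyComplex K]
    (hK : Module.finrank ℚ K = 2) (σ : K →+* ℂ)
    (m₁ m₂ : ℕ) (hm₁ : 2 ≤ m₁ + 1) (hm₂ : 4 ≤ m₂) (hm : m₁ + 1 ≤ m₂)
    (β : Fin (m₁ + 1) → ℕ) (hβ0 : β 0 = 0) (hβ : Function.Injective β)
    (H : ℝ) (hH0 : 0 < H)
    (hH : (m₂ : ℝ) * Real.log (m₂ : ℝ) ^ 2 * Real.exp ((m₂ : ℝ) * Real.log (m₂ : ℝ) ^ 2)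
      ≤ Real.log H)
    (lam : Fin (m₁ + 1) → 𝓞 K) (hlam : lam ≠ 0)
    (hdeg : (sparsePoly β lam).natDegree ≤ m₂)
    (hbound : ∀ j : Fin (m₁ + 1), j ≠ 0 → ‖σ (lam j : K)‖ ≤ H) :
    sparseBound 12.88 m₁ m₂ H < ‖evalAtE σ (sparsePoly β lam)‖ ∧
      (11 ≤ m₂ → sparseBound 2 m₁ m₂ H < ‖evalAtE σ (sparsePoly β lam)‖) := by
  classical
  set P := sparsePoly β lam with hP
  have hsub : insert 0 P.support ⊆ Finset.univ.image β :=
    Finset.insert_subset (Finset.mem_image.2 ⟨0, Finset.mem_univ _, hβ0⟩)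
      (support_sparsePoly_subset β lam)
  have hsub' : insert 0 P.support ⊆ Finset.range (m₂ + 1) :=
    Finset.insert_subset (by simp) fun i hi => by
      have := Polynomial.le_natDegree_of_mem_supp i hi
      exact Finset.mem_range.2 (by omega)
  have hcard : (insert 0 P.support).card ≤ m₁ + 1 :=
    (Finset.card_le_card hsub).trans (Finset.card_image_le.trans (by simp))
  -- An exponent with zero coefficient may exceed `m₂`, so `S` is not the set of all `β j`: it is
  -- `{0}` and the support, padded inside `[0, m₂]` to exactly `m₁ + 1` elements.
  obtain ⟨S, hTS, hSr, hScard⟩ := Finset.exists_subsuperset_card_eq hsub' hcard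
    (by rw [Finset.card_range]; omega)
  have hS : ∀ j ∈ S, j ≤ m₂ := fun j hj => Nat.lt_succ_iff.1 (Finset.mem_range.1 (hSr hj))
  have h0 : 0 ∈ S := hTS (Finset.mem_insert_self _ _)
  have hsupp : P.support ⊆ S := (Finset.subset_insert _ _).trans hTS
  have hcf : ∃ j ∈ S, P.coeff j ≠ 0 := by
    obtain ⟨j, hj⟩ := Function.ne_iff.1 hlam
    have hj' : P.coeff (β j) ≠ 0 := by rwa [hP, coeff_sparsePoly_apply hβ]
    exact ⟨β j, hsupp (Polynomial.mem_support_iff.2 hj'), hj'⟩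
  have hcH : ∀ j ∈ S, j ≠ 0 → ‖σ (P.coeff j)‖ ≤ H := by
    intro i _ hi
    by_cases hc : P.coeff i = 0
    · simpa [hc] using hH0.le
    · obtain ⟨j, -, rfl⟩ := Finset.mem_image.1
        (support_sparsePoly_subset β lam (Polynomial.mem_support_iff.2 hc))
      rw [hP, coeff_sparsePoly_apply hβ]
      exact hbound j fun hj => hi (hj ▸ hβ0)
  rw [evalAtE_eq_sum σ P hsupp]
  have hM' : (4 : ℝ) ≤ m₂ := by exact_mod_cast hm₂
  have hL := le_log_natCast hm₂
  refine ⟨?_, fun h11 => ?_⟩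
  -- `k = 2.56` is the extreme choice `25 k = 4³`.
  · refine sparseBound_lt_norm_sum_mul_exp hK σ hS h0 (by omega) hScard hm₂ hm _ hcf hH0 hH hcH
      (κ := 12.6) (k := 2.56) (by norm_num) (by norm_num) (by norm_num) ?_ (by norm_num)
      (by norm_num) ?_ fun x => one_add_mul_le_mul_log_of_four_le hm₂
    · have : (4 : ℝ) ^ 3 ≤ (m₂ : ℝ) ^ 3 := by gcongr
      linarith
    · have hs : 7.6 ≤ (m₂ : ℝ) * Real.log m₂ ^ 2 := by nlinarith
      have : 4 / (2.56 * ((m₂ : ℝ) * Real.log m₂ ^ 2)) ≤ 0.28 := by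
        rw [div_le_iff₀ (by positivity)]
        linarith
      linarith
  · have h11' : (11 : ℝ) ≤ m₂ := by exact_mod_cast h11
    have hL' := le_log_natCast_of_eleven_le h11
    -- `k = 53` is the largest integer with `25 k ≤ 11³`.
    refine sparseBound_lt_norm_sum_mul_exp hK σ hS h0 (by omega) hScard hm₂ hm _ hcf hH0 hH hcH
      (κ := 1.998) (k := 53) (by norm_num) (by norm_num) (by norm_num) ?_ (by norm_num)
      (by norm_num) ?_ fun x => one_add_mul_le_mul_log_of_eleven_le h11
    · have : (11 : ℝ) ^ 3 ≤ (m₂ : ℝ) ^ 3 := by gcongr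
      linarith
    · have hs : 60 ≤ (m₂ : ℝ) * Real.log m₂ ^ 2 := by nlinarith
      have : 4 / (53 * ((m₂ : ℝ) * Real.log m₂ ^ 2)) ≤ 0.002 := by
        rw [div_le_iff₀ (by positivity)]
        linarith
      linarith
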